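/- Let $M$ be a complex manifold of complex dimension $2$ and let $S\subset M$ be a compact regular real-analytic Levi-flat hypersurface; that is, near each of its points $S$ is, in holomorphic coordinates, the zero set of a real-analytic function $r$ with $dr\neq 0$, and the Levi form $\sum_{j,k}\frac{\partial^2 r}{\partial z_j\partial\bar z_k}v_j\bar v_k$ of each such local defining function vanishes, at the points of $S$, on the complex tangent vectors $v\in TS\cap iTS$. Such an $S$ carries the Levi foliation by complex curves, tangent to $TS\cap iTS$: its plaques are the injectively immersed holomorphic discs contained in $S$, and the leaf through a point $p\in S$ consists of the points that are joined to $p$ by a finite chain of plaques, each meeting the next one. A locally closed set $Z\subset M$ is called a local maximum set if every point of $Z$ has an open neighbourhood $V$ in $M$ such that, for every compact $N\subset V$ and every (upper semicontinuous, real-valued) plurisubharmonic function $u$ on a neighbourhood of $N$, for every $x\in Z\cap N$ there is $y\in Z\cap\partial N$ with $u(x)\le u(y)$. Let $K\subset S$ be a compact local maximum set. Then $K$ is a union of leaves of the Levi foliation of $S$. -/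

import Mathlib

open Set Metric
open scoped Manifold ContDiff

noncomputable section

namespace LeviFlat

/-- The Levi form of a real function `r` on `ℂ²` at `x`, evaluated at `v`: it equals
`∑ j k, (∂² r / ∂ z_j ∂ conj z_k)(x) * v_j * conj v_k`, written through the real Hessian. -/
def leviForm (r : ℂ × ℂ → ℝ) (x v : ℂ × ℂ) : ℝ :=
  (fderiv ℝ (fderiv ℝ r) x v v +
    fderiv ℝ (fderiv ℝ r) x (Complex.I • v) (Complex.I • v)) / 4

section Surface

variable {M : Type*} [TopologicalSpace M] [ChartedSpace (ℂ × ℂ) M]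

/-- In the holomorphic chart `e`, the function `r` is a real-analytic defining function of `S`
on the open set `U` of the chart's target: `S` corresponds to `{r = 0}` and `dr` has no zero. -/
structure IsLocalDefiningFunction (S : Set M) (e : OpenPartialHomeomorph M (ℂ × ℂ))
    (U : Set (ℂ × ℂ)) (r : ℂ × ℂ → ℝ) : Prop where
  chart : e ∈ IsManifold.maximalAtlas 𝓘(ℂ, ℂ × ℂ) ω M
  isOpen : IsOpen U
  subset_target : U ⊆ e.target
  analytic : AnalyticOnNhd ℝ r U
  mem_iff : ∀ x ∈ U, e.symm x ∈ S ↔ r x = 0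
  regular : ∀ x ∈ U, fderiv ℝ r x ≠ 0

/-- `S` is a regular real-analytic (real) hypersurface: near each of its points it is the zero
set of a real-analytic function with nowhere vanishing differential. -/
def IsRegularAnalyticHypersurface (S : Set M) : Prop :=
  ∀ p ∈ S, ∃ (e : OpenPartialHomeomorph M (ℂ × ℂ)) (U : Set (ℂ × ℂ)) (r : ℂ × ℂ → ℝ),
    IsLocalDefiningFunction S e U r ∧ p ∈ e.source ∧ e p ∈ U

/-- The Levi form of every local defining function of `S` vanishes on the complex tangent
spaces of `S`. A vector `v` is complex tangent when `v` and `i v` are both tangent. -/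
def IsLeviFlat (S : Set M) : Prop :=
  ∀ (e : OpenPartialHomeomorph M (ℂ × ℂ)) (U : Set (ℂ × ℂ)) (r : ℂ × ℂ → ℝ),
    IsLocalDefiningFunction S e U r →
    ∀ x ∈ U, r x = 0 → ∀ v : ℂ × ℂ,
      fderiv ℝ r x v = 0 → fderiv ℝ r x (Complex.I • v) = 0 → leviForm r x v = 0

/-- A plaque of the Levi foliation of `S`: an injectively immersed holomorphic disc contained
in `S`. Its tangent lines are complex lines contained in the tangent spaces of `S`, so they are
the complex tangent lines of `S`, i.e. the disc is an integral curve of the Levi distribution. -/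
def IsLeviPlaque (S P : Set M) : Prop :=
  P ⊆ S ∧ ∃ f : ℂ → M,
    MDifferentiableOn 𝓘(ℂ, ℂ) 𝓘(ℂ, ℂ × ℂ) f (ball 0 1) ∧
    InjOn f (ball 0 1) ∧
    (∀ ζ ∈ ball (0 : ℂ) 1, Function.Injective (mfderiv 𝓘(ℂ, ℂ) 𝓘(ℂ, ℂ × ℂ) f ζ)) ∧
    P = f '' ball 0 1

/-- The leaf of the Levi foliation of `S` through `p`: the points that a finite nonempty chain of
plaques, each meeting the next one, joins to `p`. In particular `p` itself belongs to it only
if some plaque passes through `p`. -/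
def leviLeaf (S : Set M) (p : M) : Set M :=
  {q | Relation.TransGen (fun x y => ∃ P : Set M, IsLeviPlaque S P ∧ x ∈ P ∧ y ∈ P) p q}

/-- `L` is a leaf of the Levi foliation of `S`. -/
def IsLeviLeaf (S L : Set M) : Prop :=
  ∃ p ∈ S, L = leviLeaf S p

/-- The function `u` is plurisubharmonic on the open set `W`: it is upper semicontinuous there
and satisfies the sub-mean value inequality on every closed holomorphic disc in `W`. -/
def IsPlurisubharmonicOn (u : M → ℝ) (W : Set M) : Prop :=
  UpperSemicontinuousOn u W ∧
  ∀ (f : ℂ → M) (R : ℝ), 1 < R →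
    MDifferentiableOn 𝓘(ℂ, ℂ) 𝓘(ℂ, ℂ × ℂ) f (ball 0 R) →
    f '' closedBall 0 1 ⊆ W →
    CircleIntegrable (fun ζ => u (f ζ)) 0 1 ∧
      u (f 0) ≤ Real.circleAverage (fun ζ => u (f ζ)) 0 1

/-- `Z` is a local maximum set: it is locally closed and each of its points has an open
neighbourhood `V` such that, for all compact `N ⊆ V` and all `u` plurisubharmonic near `N`,
the maximum of `u` on `Z ∩ N` is attained on `Z ∩ ∂N` (which must be nonempty if `Z ∩ N` is). -/
def IsLocalMaximumSet (Z : Set M) : Prop :=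
  IsLocallyClosed Z ∧
  ∀ p ∈ Z, ∃ V : Set M, IsOpen V ∧ p ∈ V ∧
    ∀ N : Set M, IsCompact N → N ⊆ V →
    ∀ (W : Set M) (u : M → ℝ), IsOpen W → N ⊆ W → IsPlurisubharmonicOn u W →
      ∀ x ∈ Z ∩ N, ∃ y ∈ Z ∩ frontier N, u x ≤ u y

end Surface

end LeviFlat

end

/-! The heart of the matter is that a plaque meeting $K$ lies in $K$
(`IsLeviPlaque.subset_of_isLocalMaximumSet`); induction along chains of plaques then shows that $K$
contains the leaf of each of its points. As $K$ is closed, only openness of the trace of $K$ on the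
plaque needs an argument.

Near a point of the plaque, take holomorphic coordinates $(z,w)$ in which the plaque is $w=0$ and
$S$ lies in the cone $|\mathrm{Im}\,w|\le|w|/4$ (`exists_adapted_chart`), so that
$\mathrm{Re}\,w^2\ge|w|^2/2$ on $S$. If $K$ misses points of the line arbitrarily close to the
centre, some disc about such a point $z_1$ is free of the slice $K\cap\{w=0\}$ and touches it at
$z_2$. The pluriharmonic function
$\mathrm{Re}\,\bigl(\frac{z_2-z_1}{z-z_1}-\frac{4}{\delta^2}w^2\bigr)$ is $1$ at $(z_2,0)$ and less
than $1$ at the points of $K$ on the boundary of a thin bidisc about it. This contradicts the local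
maximum property (`eventually_mem_of_isLocalMaximumSet`).

For $K$ to be covered, each of its points must lie on some plaque (`exists_plaque`); this is where
Levi-flatness enters. Vanishing of the Levi form makes the slope of the complex tangent lines
complex differentiable along these lines at points of $S$. Integrating the slope over rays, as in a
proof of Frobenius' theorem, yields a holomorphic graph inside $S$ (`exists_holomorphic_graph`). -/

open scoped NNReal Topology

namespace LeviFlat

/-! ### Integration of slope fields along rays -/

section

/-- Picard-Lindelöf with the information that the solution stays in the closed ball. -/
theorem exists_solution_mem_closedBall {E : Type*} [NormedAddCommGroup E] [NormedSpace ℝ E]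
    [CompleteSpace E] {f : ℝ → E → E} {tmin tmax : ℝ} {t₀ : Icc tmin tmax} {x₀ : E}
    {a L K : ℝ≥0} (hf : IsPicardLindelof f t₀ x₀ a 0 L K) :
    ∃ α : ℝ → E, α t₀ = x₀ ∧ ∀ t ∈ Icc tmin tmax,
      HasDerivWithinAt α (f t (α t)) (Icc tmin tmax) t ∧ α t ∈ closedBall x₀ a := by
  have hx : x₀ ∈ closedBall x₀ ((0 : ℝ≥0) : ℝ) := mem_closedBall_self le_rfl
  obtain ⟨α, hα⟩ := ODE.FunSpace.exists_isFixedPt_next hf hx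
  refine ⟨α.compProj, by
    rw [ODE.FunSpace.compProj_val, ← hα, ODE.FunSpace.next_apply₀],
    fun t ht ↦ ⟨?_, α.compProj_mem_closedBall hf.mul_max_le⟩⟩
  apply ODE.hasDerivWithinAt_picard_Icc t₀.2 hf.continuousOn_uncurry
    α.continuous_compProj.continuousOn (fun _ ht' ↦ α.compProj_mem_closedBall hf.mul_max_le)
    x₀ ht |>.congr_of_mem _ ht
  intro t' ht'
  nth_rw 1 [← hα]
  rw [ODE.FunSpace.compProj_of_mem ht', ODE.FunSpace.next_apply]

/-- Uniform bounds of a slope function and of its first two derivatives on a closed ball. -/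
structure SlopeBounds (a : ℂ × ℂ → ℂ) (x₀ : ℂ × ℂ) (R A K : ℝ≥0) : Prop where
  differentiableAt : ∀ x ∈ closedBall x₀ (R : ℝ), DifferentiableAt ℝ a x
  norm_le : ∀ x ∈ closedBall x₀ (R : ℝ), ‖a x‖ ≤ A
  norm_fderiv_le : ∀ x ∈ closedBall x₀ (R : ℝ), ‖fderiv ℝ a x‖ ≤ K
  norm_fderiv_sub_le : ∀ x ∈ closedBall x₀ (R : ℝ), ∀ y ∈ closedBall x₀ (R : ℝ),
    ‖fderiv ℝ a x - fderiv ℝ a y‖ ≤ K * ‖x - y‖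

theorem exists_slopeBounds {a : ℂ × ℂ → ℂ} {x₀ : ℂ × ℂ} {U : Set (ℂ × ℂ)} (hU : U ∈ 𝓝 x₀)
    (ha : ContDiffAt ℝ 2 a x₀) :
    ∃ R A K : ℝ≥0, 0 < R ∧ 0 < A ∧ 0 < K ∧ closedBall x₀ (R : ℝ) ⊆ U ∧ SlopeBounds a x₀ R A K := by
  have hd : ContDiffAt ℝ 1 (fderiv ℝ a) x₀ := ha.fderiv_right (by norm_num)
  obtain ⟨K, t, ht, hK⟩ := hd.exists_lipschitzOnWith
  have h1 : ∀ᶠ x in 𝓝 x₀, DifferentiableAt ℝ a x := by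
    filter_upwards [ha.eventually (by simp)] with x hx
    exact hx.differentiableAt (by simp)
  have h2 : ∀ᶠ x in 𝓝 x₀, ‖a x‖ < ‖a x₀‖ + 1 :=
    ha.continuousAt.norm.eventually_lt_const (by linarith)
  have h3 : ∀ᶠ x in 𝓝 x₀, ‖fderiv ℝ a x‖ < ‖fderiv ℝ a x₀‖ + 1 :=
    hd.continuousAt.norm.eventually_lt_const (by linarith)
  obtain ⟨R, hR, hball⟩ := nhds_basis_closedBall.mem_iff.1
    (Filter.inter_mem hU (Filter.inter_mem ht (h1.and (h2.and h3))))
  refine ⟨⟨R, hR.le⟩, ‖a x₀‖₊ + 1, K + ‖fderiv ℝ a x₀‖₊ + 1, hR, by positivity, by positivity,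
    fun x hx => (hball hx).1, ⟨fun x hx => (hball hx).2.2.1, fun x hx => (hball hx).2.2.2.1.le,
      fun x hx => ?_, fun x hx y hy => ?_⟩⟩
  · have := (hball hx).2.2.2.2.le
    push_cast
    have := K.coe_nonneg
    linarith
  · have := hK.norm_sub_le (hball hx).2.1 (hball hy).2.1
    refine this.trans ?_
    push_cast
    gcongr
    have := norm_nonneg (fderiv ℝ a x₀)
    linarith

variable {a : ℂ × ℂ → ℂ} {x₀ : ℂ × ℂ} {R A K : ℝ≥0}

theorem mem_closedBall_prod {x y : ℂ × ℂ} {R : ℝ} (h1 : ‖y.1 - x.1‖ ≤ R)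
    (h2 : ‖y.2 - x.2‖ ≤ R) : y ∈ closedBall x R := by
  rw [mem_closedBall, dist_eq_norm, Prod.norm_def]
  exact max_le h1 h2

theorem SlopeBounds.lipschitz (h : SlopeBounds a x₀ R A K) :
    LipschitzOnWith K a (closedBall x₀ R) :=
  (convex_closedBall _ _).lipschitzOnWith_of_nnnorm_fderiv_le h.differentiableAt
    (fun x hx => h.norm_fderiv_le x hx)

theorem SlopeBounds.taylor (h : SlopeBounds a x₀ R A K) {x y : ℂ × ℂ}
    (hx : x ∈ closedBall x₀ (R : ℝ)) (hy : y ∈ closedBall x₀ (R : ℝ)) :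
    ‖a y - a x - fderiv ℝ a x (y - x)‖ ≤ K * ‖y - x‖ ^ 2 := by
  have hseg : segment ℝ x y ⊆ closedBall x₀ (R : ℝ) :=
    (convex_closedBall _ _).segment_subset hx hy
  have := (convex_segment x y).norm_image_sub_le_of_norm_fderiv_le' (𝕜 := ℝ) (f := a)
    (φ := fderiv ℝ a x) (C := K * ‖y - x‖) (fun z hz => h.differentiableAt z (hseg hz))
    (fun z hz => (h.norm_fderiv_sub_le z (hseg hz) x hx).trans (by
      gcongr
      exact norm_sub_le_of_mem_segment hz))
    (left_mem_segment ℝ x y) (right_mem_segment ℝ x y)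
  rw [pow_two, ← mul_assoc]
  exact this

/-- The integral curve of the slope field `a` over the ray from `x₀.1` in direction `z`. -/
structure IsRadialSolution (a : ℂ × ℂ → ℂ) (x₀ : ℂ × ℂ) (ε : ℝ) (z : ℂ) (G : ℝ → ℂ) :
    Prop where
  initial : G 0 = x₀.2
  deriv : ∀ t ∈ Icc (0 : ℝ) 1,
    HasDerivWithinAt G (z * a (x₀.1 + t * z, G t)) (Icc 0 1) t
  norm_sub_le : ∀ t ∈ Icc (0 : ℝ) 1, ‖G t - x₀.2‖ ≤ ε

theorem norm_ray_le {t : ℝ} (ht : t ∈ Icc (0 : ℝ) 1) (z : ℂ) : ‖(t : ℂ) * z‖ ≤ ‖z‖ := by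
  rw [norm_mul, Complex.norm_real, Real.norm_of_nonneg ht.1]
  exact mul_le_of_le_one_left (norm_nonneg _) ht.2

/-- The direction $z$ is absorbed into the vector field, so all rays share the time interval
$[0,1]$. The speed is at most $\rho A$, which keeps the solution in the ball where the bounds hold.
-/
theorem SlopeBounds.exists_radialSolution (h : SlopeBounds a x₀ R A K) {ρ : ℝ≥0}
    (hρ : ρ ≤ R) (hρA : ρ * A ≤ R) {z : ℂ} (hz : ‖z‖ ≤ ρ) :
    ∃ G, IsRadialSolution a x₀ (ρ * A) z G := by
  have hmem : ∀ t ∈ Icc (0 : ℝ) 1, ∀ w ∈ closedBall x₀.2 ((ρ * A : ℝ≥0) : ℝ),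
      (x₀.1 + t * z, w) ∈ closedBall x₀ (R : ℝ) := by
    intro t ht w hw
    refine mem_closedBall_prod ?_ ?_
    · simpa using (norm_ray_le ht z).trans (hz.trans (by exact_mod_cast hρ))
    · rw [mem_closedBall, dist_eq_norm] at hw
      exact hw.trans (by exact_mod_cast hρA)
  have hpl : IsPicardLindelof (fun (t : ℝ) (w : ℂ) => z * a (x₀.1 + t * z, w))
      (⟨0, by simp⟩ : Icc (0 : ℝ) 1) x₀.2 (ρ * A) 0 (ρ * A) (ρ * K) := by
    refine ⟨fun t ht => ?_, fun w hw => ?_, fun t ht w hw => ?_, by simp⟩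
    · refine LipschitzOnWith.of_dist_le_mul fun w hw w' hw' => ?_
      have := h.lipschitz.dist_le_mul _ (hmem t ht w hw) _ (hmem t ht w' hw')
      rw [dist_eq_norm, ← mul_sub, norm_mul, ← dist_eq_norm]
      have h2 : dist ((x₀.1 + t * z, w) : ℂ × ℂ) (x₀.1 + t * z, w') = dist w w' := by
        rw [Prod.dist_eq]; simp
      rw [h2] at this
      push_cast
      rw [mul_assoc]
      gcongr
    · refine continuousOn_const.mul ?_
      refine h.lipschitz.continuousOn.comp (t := closedBall x₀ (R : ℝ)) (by fun_prop)
        (fun t ht => hmem t ht w hw)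
    · rw [norm_mul]
      push_cast
      gcongr
      exact h.norm_le _ (hmem t ht w hw)
  obtain ⟨G, hG0, hG⟩ := exists_solution_mem_closedBall hpl
  refine ⟨G, hG0, fun t ht => (hG t ht).1, fun t ht => ?_⟩
  have := (hG t ht).2
  rwa [mem_closedBall, dist_eq_norm] at this

theorem IsRadialSolution.mem_closedBall {ε : ℝ} {z : ℂ} {G : ℝ → ℂ}
    (hG : IsRadialSolution a x₀ ε z G) (hε : ε ≤ R) (hz : ‖z‖ ≤ R) {t : ℝ}
    (ht : t ∈ Icc (0 : ℝ) 1) : (x₀.1 + t * z, G t) ∈ closedBall x₀ (R : ℝ) :=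
  mem_closedBall_prod (by simpa using (norm_ray_le ht z).trans hz)
    ((hG.norm_sub_le t ht).trans hε)

theorem IsRadialSolution.hasDerivWithinAt_curve {ε : ℝ} {z : ℂ} {G : ℝ → ℂ}
    (hG : IsRadialSolution a x₀ ε z G) {t : ℝ} (ht : t ∈ Icc (0 : ℝ) 1) :
    HasDerivWithinAt (fun s : ℝ => ((x₀.1 + s * z, G s) : ℂ × ℂ))
      (z, z * a (x₀.1 + t * z, G t)) (Icc 0 1) t := by
  refine HasDerivWithinAt.prodMk ?_ (hG.deriv t ht)
  have : HasDerivAt (fun s : ℝ => x₀.1 + (s : ℂ) * z) (1 * z) t :=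
    ((Complex.ofRealCLM.hasDerivAt (x := t)).mul_const z).const_add _
  simpa using this.hasDerivWithinAt

/-- A function annihilated by the slope field is constant along radial solutions. -/
theorem IsRadialSolution.eq_zero {r : ℂ × ℂ → ℝ} {ε : ℝ} {z : ℂ} {G : ℝ → ℂ}
    (hG : IsRadialSolution a x₀ ε z G) (hε : ε ≤ R) (hz : ‖z‖ ≤ R)
    (hr : ∀ x ∈ closedBall x₀ (R : ℝ), DifferentiableAt ℝ r x)
    (hra : ∀ x ∈ closedBall x₀ (R : ℝ), ∀ ζ : ℂ, fderiv ℝ r x (ζ, ζ * a x) = 0)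
    (hr0 : r x₀ = 0) {t : ℝ} (ht : t ∈ Icc (0 : ℝ) 1) : r (x₀.1 + t * z, G t) = 0 := by
  have hd : ∀ t ∈ Icc (0 : ℝ) 1,
      HasDerivWithinAt (fun s : ℝ => r (x₀.1 + s * z, G s)) 0 (Icc 0 1) t := by
    intro t ht
    have hm := hG.mem_closedBall hε hz ht
    have := (hr _ hm).hasFDerivAt.comp_hasDerivWithinAt t (hG.hasDerivWithinAt_curve ht)
    rwa [hra _ hm] at this
  have := constant_of_derivWithin_zero (fun t ht => (hd t ht).differentiableWithinAt)
    (fun t ht => (hd t (Ico_subset_Icc_self ht)).derivWithin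
      (uniqueDiffOn_Icc zero_lt_one t (Ico_subset_Icc_self ht))) t ht
  rw [this, hG.initial]
  simpa using hr0

/-- Quadratic comparison of two neighbouring radial solutions. -/
theorem SlopeBounds.radialSolution_expansion (h : SlopeBounds a x₀ R A K) (hK : 0 < K)
    {ρ : ℝ≥0} (hρ : ρ ≤ R) (hρ1 : ρ ≤ 1) (hρA : 3 * (ρ * A) ≤ R) {z z' : ℂ} (hz : ‖z‖ ≤ ρ)
    (hz' : ‖z'‖ ≤ ρ)
    {G G' : ℝ → ℂ} (hG : IsRadialSolution a x₀ (ρ * A) z G)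
    (hG' : IsRadialSolution a x₀ (ρ * A) z' G')
    (hint : ∀ t ∈ Icc (0 : ℝ) 1, ∀ ζ : ℂ,
      fderiv ℝ a (x₀.1 + t * z, G t) (ζ, ζ * a (x₀.1 + t * z, G t)) =
        ζ * fderiv ℝ a (x₀.1 + t * z, G t) (1, a (x₀.1 + t * z, G t))) :
    ‖G' 1 - G 1 - (z' - z) * a (x₀.1 + z, G 1)‖ ≤
      2 * K * (1 + A) ^ 2 / K * (Real.exp K - 1) * ‖z' - z‖ ^ 2 := by
  set k := z' - z with hk
  have hρA1 : (ρ : ℝ) * A ≤ R := by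
    have : (3 * (ρ * A) : ℝ) ≤ R := by exact_mod_cast hρA
    have : (0 : ℝ) ≤ ρ * A := by positivity
    linarith
  have hρR : (ρ : ℝ) ≤ R := by exact_mod_cast hρ
  have hkn : ‖k‖ ≤ 2 * ρ := by
    have := norm_sub_le z' z
    linarith
  set X : ℝ → ℂ × ℂ := fun t => (x₀.1 + t * z, G t) with hX
  have hXm : ∀ t ∈ Icc (0 : ℝ) 1, X t ∈ closedBall x₀ (R : ℝ) := fun t ht =>
    hG.mem_closedBall hρA1 (hz.trans hρR) ht
  set b : ℝ → ℂ := fun t => fderiv ℝ a (X t) (1, a (X t)) with hb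
  have haX : ∀ t ∈ Icc (0 : ℝ) 1, HasDerivWithinAt (fun s => a (X s)) (z * b t) (Icc 0 1) t := by
    intro t ht
    have := (h.differentiableAt _ (hXm t ht)).hasFDerivAt.comp_hasDerivWithinAt t
      (hG.hasDerivWithinAt_curve ht)
    rwa [hint t ht] at this
  -- First-order guess for the solution over the ray $z'$: displace the point $X(t)$ by $tk$ along
  -- its complex tangent line.
  set E : ℝ → ℂ := fun t => G t + t * (k * a (X t)) with hE
  set E' : ℝ → ℂ := fun t => z * a (X t) + (1 * (k * a (X t)) + t * (k * (z * b t))) with hE'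
  have hEd : ∀ t ∈ Icc (0 : ℝ) 1, HasDerivWithinAt E (E' t) (Icc 0 1) t := by
    intro t ht
    exact (hG.deriv t ht).add ((Complex.ofRealCLM.hasDerivAt (x := t)).hasDerivWithinAt.mul
      ((haX t ht).const_mul k))
  have hEn : ∀ t ∈ Icc (0 : ℝ) 1, ‖E t - x₀.2‖ ≤ R := by
    intro t ht
    have h1 := hG.norm_sub_le t ht
    have h2 : ‖(t : ℂ) * (k * a (X t))‖ ≤ 2 * ρ * A := by
      refine (norm_ray_le ht _).trans ?_
      rw [norm_mul]
      gcongr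
      exact h.norm_le _ (hXm t ht)
    have h3 : ‖E t - x₀.2‖ ≤ ‖G t - x₀.2‖ + ‖(t : ℂ) * (k * a (X t))‖ := by
      rw [hE, add_sub_right_comm]
      exact norm_add_le _ _
    have : (3 * (ρ * A) : ℝ) ≤ R := by exact_mod_cast hρA
    linarith
  have hYm : ∀ t ∈ Icc (0 : ℝ) 1, ∀ w ∈ closedBall x₀.2 (R : ℝ),
      (x₀.1 + t * z', w) ∈ closedBall x₀ (R : ℝ) := fun t ht w hw =>
    mem_closedBall_prod (by simpa using (norm_ray_le ht z').trans (hz'.trans hρR))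
      (by rwa [mem_closedBall, dist_eq_norm] at hw)
  -- Grönwall with equal initial values, `G'` exact and `E` approximate. The factor 2 in the error
  -- counts the Taylor remainder of $a$ and the leftover term $tk^2b$.
  have hgron := dist_le_of_approx_trajectories_ODE_of_mem (a := 0) (b := 1) (K := K)
    (v := fun (t : ℝ) (w : ℂ) => z' * a (x₀.1 + t * z', w))
    (s := fun _ => closedBall x₀.2 (R : ℝ)) (f := G') (g := E)
    (f' := fun t => z' * a (x₀.1 + t * z', G' t)) (g' := E') (εf := 0)
    (εg := 2 * K * (1 + A) ^ 2 * ‖k‖ ^ 2) (δ := 0)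
    (fun t ht => by
      refine LipschitzOnWith.of_dist_le_mul fun w hw w' hw' => ?_
      have ht' := Ico_subset_Icc_self ht
      have := h.lipschitz.dist_le_mul _ (hYm t ht' w hw) _ (hYm t ht' w' hw')
      rw [dist_eq_norm, ← mul_sub, norm_mul, ← dist_eq_norm]
      have h2 : dist ((x₀.1 + t * z', w) : ℂ × ℂ) (x₀.1 + t * z', w') = dist w w' := by
        rw [Prod.dist_eq]; simp
      rw [h2] at this
      have h3 : ‖z'‖ ≤ 1 := hz'.trans (by exact_mod_cast hρ1)
      exact (mul_le_of_le_one_left dist_nonneg h3).trans this)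
    (fun t ht => (hG'.deriv t ht).continuousWithinAt)
    (fun t ht => (hG'.deriv t (Ico_subset_Icc_self ht)).mono_of_mem_nhdsWithin
      (Icc_mem_nhdsGE_of_mem ht))
    (fun t ht => by simp)
    (fun t ht => by
      rw [mem_closedBall, dist_eq_norm]
      exact (hG'.norm_sub_le t (Ico_subset_Icc_self ht)).trans hρA1)
    (fun t ht => (hEd t ht).continuousWithinAt)
    (fun t ht => (hEd t (Ico_subset_Icc_self ht)).mono_of_mem_nhdsWithin
      (Icc_mem_nhdsGE_of_mem ht))
    (fun t ht => by
      have ht' := Ico_subset_Icc_self ht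
      have hm := hYm t ht' (E t) (by rw [mem_closedBall, dist_eq_norm]; exact hEn t ht')
      have htay := h.taylor (hXm t ht') hm
      have hdiff : ((x₀.1 + t * z', E t) : ℂ × ℂ) - X t = (t * k, t * k * a (X t)) := by
        ext <;> simp [hX, hE, hk] <;> ring
      have hint' := hint t ht' (t * k)
      have hnorm : ‖((x₀.1 + t * z', E t) : ℂ × ℂ) - X t‖ ≤ (1 + A) * ‖k‖ := by
        rw [hdiff, Prod.norm_def]
        have h1 := norm_ray_le ht' k
        have h2 := h.norm_le _ (hXm t ht')
        refine max_le (h1.trans ?_) ?_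
        · have : 0 ≤ (A : ℝ) * ‖k‖ := by positivity
          linarith
        · simp only [norm_mul _ (a (X t))]
          have : ‖(t : ℂ) * k‖ * ‖a (X t)‖ ≤ ‖k‖ * A := by gcongr
          have := norm_nonneg k
          linarith
      rw [hdiff] at htay
      rw [hdiff] at hnorm
      change fderiv ℝ a (X t) (t * k, t * k * a (X t)) = t * k * b t at hint'
      rw [hint'] at htay
      have hbn : ‖b t‖ ≤ K * (1 + A) := by
        refine (ContinuousLinearMap.le_opNorm _ _).trans ?_
        gcongr
        · exact h.norm_fderiv_le _ (hXm t ht')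
        · rw [Prod.norm_def]
          have := h.norm_le _ (hXm t ht')
          have hA := A.coe_nonneg
          refine max_le ?_ ?_
          · simp
          · simp only
            linarith
      -- All terms of first order in $k$ cancel; this uses that $a$ has derivative $tk\,b$, complex
      -- linear in $tk$, along the tangent line.
      have hid : E' t - z' * a (x₀.1 + t * z', E t) =
          -(z' * (a (x₀.1 + t * z', E t) - a (X t) - t * k * b t)) - t * (k ^ 2 * b t) := by
        simp only [hE', hk]; ring
      rw [dist_eq_norm, hid]
      refine (norm_sub_le _ _).trans ?_
      have e1 : ‖-(z' * (a (x₀.1 + t * z', E t) - a (X t) - t * k * b t))‖ ≤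
          1 * (K * ((1 + A) * ‖k‖) ^ 2) := by
        rw [norm_neg, norm_mul]
        have h3 : ‖z'‖ ≤ 1 := hz'.trans (by exact_mod_cast hρ1)
        gcongr
        exact htay.trans (by gcongr)
      have e2 : ‖(t : ℂ) * (k ^ 2 * b t)‖ ≤ ‖k‖ ^ 2 * (K * (1 + A)) := by
        refine (norm_ray_le ht' _).trans ?_
        rw [norm_mul, norm_pow]
        gcongr
      have e3 : ‖k‖ ^ 2 * (K * (1 + A)) ≤ ‖k‖ ^ 2 * (K * (1 + A) ^ 2) := by
        have hA := A.coe_nonneg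
        gcongr
        nlinarith
      nlinarith)
    (fun t ht => by
      rw [mem_closedBall, dist_eq_norm]; exact hEn t (Ico_subset_Icc_self ht))
    (by simp [hE, hG.initial, hG'.initial]) 1 (by simp)
  have hE1 : E 1 = G 1 + k * a (x₀.1 + z, G 1) := by simp [hE, hX]
  rw [dist_eq_norm, hE1, ← sub_sub] at hgron
  refine hgron.trans (le_of_eq ?_)
  rw [gronwallBound_of_K_ne_0 (by exact_mod_cast hK.ne')]
  simp only [zero_mul, zero_add, sub_zero, mul_one]
  ring

/-- Integration of a slope field that is involutive along the zero set of a function it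
annihilates: the solution is a holomorphic graph contained in this zero set. -/
theorem exists_holomorphic_graph {r : ℂ × ℂ → ℝ} {U : Set (ℂ × ℂ)} (hU : U ∈ 𝓝 x₀)
    (ha : ContDiffAt ℝ 2 a x₀) (hr : ∀ x ∈ U, DifferentiableAt ℝ r x)
    (hra : ∀ x ∈ U, ∀ ζ : ℂ, fderiv ℝ r x (ζ, ζ * a x) = 0) (hr0 : r x₀ = 0)
    (hint : ∀ x ∈ U, r x = 0 → ∀ ζ : ℂ,
      fderiv ℝ a x (ζ, ζ * a x) = ζ * fderiv ℝ a x (1, a x)) :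
    ∃ ρ > (0 : ℝ), ∃ g : ℂ → ℂ, g x₀.1 = x₀.2 ∧ ∀ z ∈ ball x₀.1 ρ,
      (z, g z) ∈ U ∧ r (z, g z) = 0 ∧ DifferentiableAt ℂ g z := by
  obtain ⟨R, A, K, hR, hA, hK, hRU, h⟩ := exists_slopeBounds hU ha
  -- In $3\rho A\le R$, one $\rho A$ bounds the drift of a solution and two bound the displacement
  -- $|z'-z|A$ of the comparison curve.
  obtain ⟨ρ, hρ0, hρR, hρ1, hρA⟩ : ∃ ρ : ℝ≥0, 0 < ρ ∧ ρ ≤ R ∧ ρ ≤ 1 ∧ 3 * (ρ * A) ≤ R := by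
    refine ⟨min (min R 1) (R / (3 * A)), by positivity, (min_le_left _ _).trans (min_le_left _ _),
      (min_le_left _ _).trans (min_le_right _ _), ?_⟩
    calc 3 * (min (min R 1) (R / (3 * A)) * A) ≤ 3 * (R / (3 * A) * A) := by
          gcongr; exact min_le_right _ _
      _ = R := by field_simp
  have hρA1 : ρ * A ≤ R := le_trans (le_mul_of_one_le_left (by positivity) (by norm_num)) hρA
  have hρA1' : (ρ : ℝ) * A ≤ R := by exact_mod_cast hρA1
  have hρR' : (ρ : ℝ) ≤ R := by exact_mod_cast hρR
  have hex : ∀ z : ℂ, ∃ G, ‖z‖ ≤ ρ → IsRadialSolution a x₀ (ρ * A) z G := fun z => by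
    by_cases hz : ‖z‖ ≤ ρ
    · obtain ⟨G, hG⟩ := h.exists_radialSolution hρR hρA1 hz
      exact ⟨G, fun _ => hG⟩
    · exact ⟨0, fun hz' => absurd hz' hz⟩
  choose G hG using hex
  have hone : (1 : ℝ) ∈ Icc (0 : ℝ) 1 := by simp
  have hzero : ∀ z : ℂ, ‖z‖ ≤ ρ → ∀ t ∈ Icc (0 : ℝ) 1, r (x₀.1 + t * z, G z t) = 0 :=
    fun z hz t ht => (hG z hz).eq_zero hρA1' (hz.trans hρR') (fun x hx => hr x (hRU hx))
      (fun x hx => hra x (hRU hx)) hr0 ht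
  have hmem : ∀ z : ℂ, ‖z‖ ≤ ρ → ∀ t ∈ Icc (0 : ℝ) 1, (x₀.1 + t * z, G z t) ∈ U :=
    fun z hz t ht => hRU ((hG z hz).mem_closedBall hρA1' (hz.trans hρR') ht)
  have hexp : ∀ z z' : ℂ, ‖z‖ ≤ ρ → ‖z'‖ ≤ ρ → _ := fun z z' hz hz' =>
    h.radialSolution_expansion hK hρR hρ1 hρA hz hz' (hG z hz) (hG z' hz')
      (fun t ht ζ => hint _ (hmem z hz t ht) (hzero z hz t ht) ζ)
  refine ⟨ρ, hρ0, fun z => G (z - x₀.1) 1, ?_, fun z hz => ?_⟩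
  · have h0 := hG 0 (by simp)
    have hc := constant_of_derivWithin_zero (fun t ht => (h0.deriv t ht).differentiableWithinAt)
      (fun t ht => by
        rw [(h0.deriv t (Ico_subset_Icc_self ht)).derivWithin
          (uniqueDiffOn_Icc zero_lt_one t (Ico_subset_Icc_self ht))]
        simp) 1 hone
    simp only [sub_self]
    rw [hc, h0.initial]
  · rw [mem_ball, dist_eq_norm] at hz
    refine ⟨by simpa using hmem _ hz.le 1 hone, by simpa using hzero _ hz.le 1 hone, ?_⟩
    -- The quadratic comparison says that the endpoint map has the complex derivative $a(z,g(z))$.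
    have : HasDerivAt (fun z => G (z - x₀.1) 1) (a (z, G (z - x₀.1) 1)) z := by
      rw [hasDerivAt_iff_isLittleO]
      set C := 2 * K * (1 + A) ^ 2 / K * (Real.exp K - 1)
      have hO : (fun z' => G (z' - x₀.1) 1 - G (z - x₀.1) 1 -
          (z' - z) • a (z, G (z - x₀.1) 1)) =O[𝓝 z] fun z' => ‖z' - z‖ ^ 2 := by
        refine Asymptotics.IsBigO.of_bound C ?_
        have : ball x₀.1 ρ ∈ 𝓝 z := isOpen_ball.mem_nhds (by rwa [mem_ball, dist_eq_norm])
        filter_upwards [this] with z' hz'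
        rw [mem_ball, dist_eq_norm] at hz'
        have := hexp _ _ hz.le hz'.le
        simpa using this
      refine hO.trans_isLittleO ?_
      have : (fun z' => ‖z' - z‖ ^ 2) =o[𝓝 z] fun z' => ‖z' - z‖ ^ 1 := by
        have h1 : Filter.Tendsto (fun z' => ‖z' - z‖) (𝓝 z) (𝓝 0) := by
          have : Continuous fun z' : ℂ => ‖z' - z‖ := by fun_prop
          simpa using this.tendsto z
        exact (Asymptotics.isLittleO_pow_pow (by norm_num)).comp_tendsto h1
      simpa using this.norm_right
    exact this.differentiableAt

end

/-! ### Complex tangent slopes and discs in Levi-flat hypersurfaces of ℂ² -/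

section

/-- The value at `v` of the complex-linear form with real part `φ`, as a function of `φ`. -/
noncomputable def complexify (v : ℂ × ℂ) : (ℂ × ℂ →L[ℝ] ℝ) →L[ℝ] ℂ :=
  Complex.ofRealCLM.comp (ContinuousLinearMap.apply ℝ ℝ v) -
    Complex.I • Complex.ofRealCLM.comp (ContinuousLinearMap.apply ℝ ℝ (Complex.I • v))

theorem complexify_apply (v : ℂ × ℂ) (φ : ℂ × ℂ →L[ℝ] ℝ) :
    complexify v φ = φ v - Complex.I * φ (Complex.I • v) := by
  simp [complexify]

theorem complexify_re (v : ℂ × ℂ) (φ : ℂ × ℂ →L[ℝ] ℝ) : (complexify v φ).re = φ v := by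
  simp [complexify_apply]

theorem complexify_add (v w : ℂ × ℂ) (φ : ℂ × ℂ →L[ℝ] ℝ) :
    complexify (v + w) φ = complexify v φ + complexify w φ := by
  simp only [complexify_apply, smul_add, map_add]
  push_cast
  ring

theorem smul_eq_re_add_im (c : ℂ) (v : ℂ × ℂ) :
    c • v = c.re • v + c.im • (Complex.I • v) := by
  ext
  · simp
    linear_combination (-v.1) * Complex.re_add_im c
  · simp
    linear_combination (-v.2) * Complex.re_add_im c

theorem complexify_smul (c : ℂ) (v : ℂ × ℂ) (φ : ℂ × ℂ →L[ℝ] ℝ) :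
    complexify (c • v) φ = c * complexify v φ := by
  have h1 := smul_eq_re_add_im c v
  have h2 : Complex.I • (c • v) = c.re • (Complex.I • v) - c.im • v := by
    rw [h1]
    ext
    · simp
      linear_combination (c.im * v.1) * Complex.I_sq
    · simp
      linear_combination (c.im * v.2) * Complex.I_sq
  rw [complexify_apply, complexify_apply, h2, h1, map_add, map_sub]
  simp only [map_smul, smul_eq_mul]
  push_cast
  conv_rhs => rw [← Complex.re_add_im c]
  linear_combination (c.im : ℂ) * (φ (Complex.I • v)) * Complex.I_sq

theorem complexify_mk (z w : ℂ) (φ : ℂ × ℂ →L[ℝ] ℝ) :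
    complexify (z, w) φ = z * complexify (1, 0) φ + w * complexify (0, 1) φ := by
  rw [← complexify_smul, ← complexify_smul, ← complexify_add]
  simp

/-- The slope of the complex tangent lines of the level sets of `r`. -/
noncomputable def slope (r : ℂ × ℂ → ℝ) (x : ℂ × ℂ) : ℂ :=
  -complexify (1, 0) (fderiv ℝ r x) / complexify (0, 1) (fderiv ℝ r x)

variable {r : ℂ × ℂ → ℝ} {x : ℂ × ℂ}

/-- Since `complexify v φ` combines $\varphi(v)$ and $\varphi(iv)$, its vanishing is exactly complex
tangency of $v$. -/
theorem complexify_slope (h : complexify (0, 1) (fderiv ℝ r x) ≠ 0) (ζ : ℂ) :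
    complexify (ζ, ζ * slope r x) (fderiv ℝ r x) = 0 := by
  rw [complexify_mk, slope]
  field_simp
  ring

theorem fderiv_slope_eq_zero (h : complexify (0, 1) (fderiv ℝ r x) ≠ 0) (ζ : ℂ) :
    fderiv ℝ r x (ζ, ζ * slope r x) = 0 := by
  rw [← complexify_re, complexify_slope h, Complex.zero_re]

theorem contDiffAt_slope (hr : AnalyticAt ℝ r x)
    (h : complexify (0, 1) (fderiv ℝ r x) ≠ 0) : ContDiffAt ℝ 2 (slope r) x := by
  have h1 : ContDiffAt ℝ 2 (fderiv ℝ r) x := hr.fderiv.contDiffAt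
  exact ((complexify (1, 0)).contDiff.contDiffAt.comp x h1).neg.mul
    (((complexify (0, 1)).contDiff.contDiffAt.comp x h1).inv h)

/-- Along a zero of the Levi form the slope is complex differentiable in the complex tangent
direction. -/
theorem fderiv_slope_tangent (hr : AnalyticAt ℝ r x)
    (h : complexify (0, 1) (fderiv ℝ r x) ≠ 0) (hL : leviForm r x (1, slope r x) = 0) (ζ : ℂ) :
    fderiv ℝ (slope r) x (ζ, ζ * slope r x) = ζ * fderiv ℝ (slope r) x (1, slope r x) := by
  have hd : DifferentiableAt ℝ (fderiv ℝ r) x := hr.fderiv.differentiableAt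
  have hs : DifferentiableAt ℝ (slope r) x := (contDiffAt_slope hr h).differentiableAt (by simp)
  set H := fderiv ℝ (fderiv ℝ r) x with hH
  set v : ℂ × ℂ := (1, slope r x) with hv
  have hsym : ∀ u w, H u w = H w u :=
    (hr.contDiffAt (n := 2)).isSymmSndFDerivAt (by simp)
  have hΛ : ∀ w, HasFDerivAt (fun y => complexify w (fderiv ℝ r y)) ((complexify w).comp H) x :=
    fun w => (complexify w).hasFDerivAt.comp x hd.hasFDerivAt
  have hne : ∀ᶠ y in 𝓝 x, complexify (0, 1) (fderiv ℝ r y) ≠ 0 :=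
    (hΛ (0, 1)).continuousAt.eventually_ne h
  have hzero : (fun y => complexify (1, 0) (fderiv ℝ r y) +
      slope r y * complexify (0, 1) (fderiv ℝ r y)) =ᶠ[𝓝 x] fun _ => 0 := by
    filter_upwards [hne] with y hy
    have := complexify_slope hy 1
    rw [complexify_mk] at this
    simpa using this
  -- Derivative in direction $u$ of the identity $r_z+s\,r_w=0$ that defines the slope $s$.
  have hder : ∀ u, complexify v (H u) +
      fderiv ℝ (slope r) x u * complexify (0, 1) (fderiv ℝ r x) = 0 := by
    intro u
    have h1 := ((hΛ (1, 0)).add (hs.hasFDerivAt.mul (hΛ (0, 1)))).congr_of_eventuallyEq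
      hzero.symm
    have h2 := DFunLike.congr_fun (h1.unique (hasFDerivAt_const (0 : ℂ) x)) u
    simp at h2
    rw [hv, complexify_mk]
    linear_combination h2
  -- A zero of the Levi form means $H(iv,iv)=-H(v,v)$. With the symmetry of $H$, this makes
  -- $u\mapsto$ `complexify v (H u)` complex linear on the line $\mathbb{C}v$.
  have hI : complexify v (H (Complex.I • v)) = Complex.I * complexify v (H v) := by
    rw [complexify_apply, complexify_apply]
    have hL' : H (Complex.I • v) (Complex.I • v) = - H v v := by
      have : (H v v + H (Complex.I • v) (Complex.I • v)) / 4 = 0 := hL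
      linarith
    rw [hL', hsym (Complex.I • v) v]
    push_cast
    linear_combination (H v (Complex.I • v) : ℂ) * Complex.I_sq
  have hDI : fderiv ℝ (slope r) x (Complex.I • v) = Complex.I * fderiv ℝ (slope r) x v := by
    have h1 := hder (Complex.I • v)
    have h2 := hder v
    rw [hI] at h1
    refine mul_right_cancel₀ h ?_
    linear_combination h1 - Complex.I * h2
  have hζ : ((ζ, ζ * slope r x) : ℂ × ℂ) = ζ.re • v + ζ.im • (Complex.I • v) := by
    rw [← smul_eq_re_add_im, hv]
    simp
  rw [hζ, map_add, map_smul, map_smul, hDI, Complex.real_smul, Complex.real_smul]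
  conv_rhs => rw [← Complex.re_add_im ζ]
  ring

/-- The Levi-flatness of `{r = 0}` inside an open set of `ℂ²`. -/
def LeviFlatOn (r : ℂ × ℂ → ℝ) (U : Set (ℂ × ℂ)) : Prop :=
  ∀ x ∈ U, r x = 0 → ∀ v : ℂ × ℂ,
    fderiv ℝ r x v = 0 → fderiv ℝ r x (Complex.I • v) = 0 → leviForm r x v = 0

/-- An injectively immersed holomorphic disc in `ℂ²` through `x`, contained in `{r = 0}`. -/
def HasDisc (r : ℂ × ℂ → ℝ) (U : Set (ℂ × ℂ)) (x : ℂ × ℂ) : Prop :=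
  ∃ f : ℂ → ℂ × ℂ, f 0 = x ∧ InjOn f (ball 0 1) ∧ ∀ ζ ∈ ball (0 : ℂ) 1,
    f ζ ∈ U ∧ r (f ζ) = 0 ∧ DifferentiableAt ℂ f ζ ∧ Function.Injective (fderiv ℂ f ζ)

/-- Where $r_w\ne0$ the complex tangent lines are graphs over the $z$-axis, so the slope field can
be integrated. The resulting disc is a graph, whose first coordinate alone gives injectivity and
immersion. -/
theorem hasDisc_of_transverse {U : Set (ℂ × ℂ)} (hU : IsOpen U) (hr : AnalyticOnNhd ℝ r U)
    (hL : LeviFlatOn r U) (hx : x ∈ U) (hx0 : r x = 0)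
    (h : complexify (0, 1) (fderiv ℝ r x) ≠ 0) : HasDisc r U x := by
  have hcont : ContinuousOn (fun y => complexify (0, 1) (fderiv ℝ r y)) U :=
    (complexify (0, 1)).continuous.comp_continuousOn hr.fderiv.continuousOn
  set U' := U ∩ (fun y => complexify (0, 1) (fderiv ℝ r y)) ⁻¹' {0}ᶜ with hU'
  have hU'o : IsOpen U' := hcont.isOpen_inter_preimage hU isOpen_compl_singleton
  obtain ⟨ρ, hρ, g, hg0, hg⟩ := exists_holomorphic_graph (a := slope r) (r := r) (x₀ := x)
    (hU'o.mem_nhds ⟨hx, h⟩) (contDiffAt_slope (hr x hx) h)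
    (fun y hy => (hr y hy.1).differentiableAt) (fun y hy ζ => fderiv_slope_eq_zero hy.2 ζ) hx0
    (fun y hy hy0 ζ => fderiv_slope_tangent (hr y hy.1) hy.2 (hL y hy.1 hy0 _
      (by simpa using fderiv_slope_eq_zero hy.2 1)
      (by simpa using fderiv_slope_eq_zero hy.2 Complex.I)) ζ)
  have hm : ∀ ζ ∈ ball (0 : ℂ) 1, x.1 + ρ * ζ ∈ ball x.1 ρ := by
    intro ζ hζ
    rw [mem_ball_zero_iff] at hζ
    rw [mem_ball, dist_eq_norm, add_sub_cancel_left, norm_mul, Complex.norm_real,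
      Real.norm_of_nonneg hρ.le]
    exact mul_lt_of_lt_one_right hρ hζ
  have hρc : (ρ : ℂ) ≠ 0 := by exact_mod_cast hρ.ne'
  refine ⟨fun ζ => (x.1 + ρ * ζ, g (x.1 + ρ * ζ)), by simp [hg0], ?_, fun ζ hζ => ?_⟩
  · intro ζ _ ζ' _ heq
    have := congrArg Prod.fst heq
    simpa [hρc] using this
  · obtain ⟨h1, h2, h3⟩ := hg _ (hm ζ hζ)
    have hlin : HasDerivAt (fun ζ : ℂ => x.1 + ρ * ζ) ρ ζ := by
      simpa using ((hasDerivAt_id ζ).const_mul (ρ : ℂ)).const_add x.1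
    have hgd : DifferentiableAt ℂ (fun ζ : ℂ => g (x.1 + ρ * ζ)) ζ :=
      h3.comp ζ hlin.differentiableAt
    have hd := hlin.hasFDerivAt.prodMk hgd.hasFDerivAt
    refine ⟨h1.1, h2, hd.differentiableAt, ?_⟩
    rw [hd.fderiv]
    intro s t hst
    have := congrArg Prod.fst hst
    simpa [hρc] using this

/-- The swap is complex linear, so it commutes with multiplication by $i$ and carries the Levi form
over. -/
theorem leviForm_comp_swap (hr : AnalyticAt ℝ r x.swap) (v : ℂ × ℂ) :
    leviForm (r ∘ Prod.swap) x v = leviForm r x.swap v.swap := by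
  set σ := (ContinuousLinearEquiv.prodComm ℝ ℂ ℂ : (ℂ × ℂ) ≃L[ℝ] (ℂ × ℂ)) with hσ
  have h1 : fderiv ℝ (r ∘ Prod.swap) = fun y => (fderiv ℝ r (σ y)).comp (σ : ℂ × ℂ →L[ℝ] ℂ × ℂ) := by
    funext y
    exact σ.comp_right_fderiv (f := r)
  have h2 : fderiv ℝ (fderiv ℝ (r ∘ Prod.swap)) x =
      ((ContinuousLinearMap.compL ℝ (ℂ × ℂ) (ℂ × ℂ) ℝ).flip (σ : ℂ × ℂ →L[ℝ] ℂ × ℂ)).comp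
        ((fderiv ℝ (fderiv ℝ r) (σ x)).comp (σ : ℂ × ℂ →L[ℝ] ℂ × ℂ)) := by
    rw [h1]
    have hd : DifferentiableAt ℝ (fderiv ℝ r) (σ x) := hr.fderiv.differentiableAt
    exact (((ContinuousLinearMap.compL ℝ (ℂ × ℂ) (ℂ × ℂ) ℝ).flip
      (σ : ℂ × ℂ →L[ℝ] ℂ × ℂ)).hasFDerivAt.comp x
        (hd.hasFDerivAt.comp x σ.hasFDerivAt)).fderiv
  unfold leviForm
  rw [h2]
  rfl

/-- As $dr\ne0$, one of $r_z$, $r_w$ is nonzero; exchanging the coordinates reduces the first case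
to the second. -/
theorem hasDisc {U : Set (ℂ × ℂ)} (hU : IsOpen U) (hr : AnalyticOnNhd ℝ r U)
    (hL : LeviFlatOn r U) (hx : x ∈ U) (hx0 : r x = 0) (hd : fderiv ℝ r x ≠ 0) :
    HasDisc r U x := by
  by_cases h : complexify (0, 1) (fderiv ℝ r x) = 0
  · set σ := (ContinuousLinearEquiv.prodComm ℝ ℂ ℂ : (ℂ × ℂ) ≃L[ℝ] (ℂ × ℂ)) with hσ
    have h1 : ∀ y, fderiv ℝ (r ∘ Prod.swap) y =
        (fderiv ℝ r y.swap).comp (σ : ℂ × ℂ →L[ℝ] ℂ × ℂ) :=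
      fun y => σ.comp_right_fderiv (f := r)
    have hsw : HasDisc (r ∘ Prod.swap) (Prod.swap ⁻¹' U) x.swap := by
      refine hasDisc_of_transverse (hU.preimage continuous_swap) (fun y hy => ?_)
        (fun y hy hy0 v hv hv' => ?_) (by simpa using hx) (by simpa using hx0) ?_
      · exact (hr _ hy).comp (f := Prod.swap) (σ.toContinuousLinearMap.analyticAt y)
      · rw [leviForm_comp_swap (hr _ hy)]
        rw [h1] at hv hv'
        exact hL _ hy hy0 _ hv hv'
      · rw [h1, Prod.swap_swap]
        have h2 : complexify (0, 1) ((fderiv ℝ r x).comp (σ : ℂ × ℂ →L[ℝ] ℂ × ℂ)) =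
            complexify (1, 0) (fderiv ℝ r x) := by
          rw [complexify_apply, complexify_apply]; rfl
        rw [h2]
        intro h3
        refine hd (ContinuousLinearMap.ext fun v => ?_)
        rw [← complexify_re, complexify_mk, h, h3]
        simp
    obtain ⟨f, hf0, hfi, hf⟩ := hsw
    refine ⟨fun ζ => (f ζ).swap, by simp [hf0], fun ζ hζ ζ' hζ' heq =>
      hfi hζ hζ' (Prod.swap_injective heq), fun ζ hζ => ?_⟩
    obtain ⟨h4, h5, h6, h7⟩ := hf ζ hζ
    have h8 := (ContinuousLinearEquiv.prodComm ℂ ℂ ℂ).hasFDerivAt.comp ζ h6.hasFDerivAt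
    refine ⟨h4, h5, h8.differentiableAt, ?_⟩
    have h9 : fderiv ℂ (fun ζ => (f ζ).swap) ζ = _ := h8.fderiv
    rw [h9]
    exact (ContinuousLinearEquiv.prodComm ℂ ℂ ℂ).injective.comp h7
  · exact hasDisc_of_transverse hU hr hL hx hx0 h

end

/-! ### Plaques and adapted holomorphic coordinates -/

section

/-- A holomorphic curve in `{r = 0}` can be straightened, in such a way that `{r = 0}` becomes
tangent to `ℂ × ℝ` at the given point and lies in a narrow cone around it. -/
theorem exists_straightening {r : ℂ × ℂ → ℝ} {F : ℂ → ℂ × ℂ} {ζ₀ : ℂ}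
    (hr : AnalyticAt ℝ r (F ζ₀)) (hd : fderiv ℝ r (F ζ₀) ≠ 0)
    (hF : ∀ᶠ ζ in 𝓝 ζ₀, DifferentiableAt ℂ F ζ ∧ r (F ζ) = 0) (hF' : deriv F ζ₀ ≠ 0) :
    ∃ T : OpenPartialHomeomorph (ℂ × ℂ) (ℂ × ℂ), (ζ₀, 0) ∈ T.source ∧
      (∀ ζ, T (ζ, 0) = F ζ) ∧ ∀ᶠ x in 𝓝 (F ζ₀), DifferentiableAt ℂ T.symm x ∧
        (r x = 0 → |(T.symm x).2.im| ≤ ‖(T.symm x).2‖ / 4) := by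
  set φ := fderiv ℝ r (F ζ₀) with hφ
  obtain ⟨v, hv⟩ : ∃ v, complexify v φ ≠ 0 := by
    by_contra! h
    exact hd (ContinuousLinearMap.ext fun v => by rw [← complexify_re, h]; rfl)
  -- Normalized so that $dr(wn)=\mathrm{Im}\,w$: in the coordinates $F(z)+wn$ the tangent space of
  -- $\{r=0\}$ is $\mathrm{Im}\,w=0$.
  set n := (-Complex.I / complexify v φ) • v with hn
  have hnφ : complexify n φ = -Complex.I := by
    rw [hn, complexify_smul]
    field_simp
  have hFd : HasDerivAt F (deriv F ζ₀) ζ₀ := hF.self_of_nhds.1.hasDerivAt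
  have htan : ∀ s : ℂ, φ (s • deriv F ζ₀) = 0 := by
    intro s
    have h2 := (hr.differentiableAt.hasFDerivAt.comp ζ₀ (hFd.hasFDerivAt.restrictScalars ℝ))
    have h3 : (r ∘ F) =ᶠ[𝓝 ζ₀] fun _ => 0 := by
      filter_upwards [hF] with ζ hζ using hζ.2
    have h4 := DFunLike.congr_fun
      (h2.unique ((hasFDerivAt_const (0 : ℝ) ζ₀).congr_of_eventuallyEq h3)) s
    simpa using h4
  have htanc : complexify (deriv F ζ₀) φ = 0 := by
    rw [complexify_apply, htan]
    simpa using htan 1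
  set L : ℂ × ℂ →L[ℂ] ℂ × ℂ :=
    (ContinuousLinearMap.fst ℂ ℂ ℂ).smulRight (deriv F ζ₀) +
      (ContinuousLinearMap.snd ℂ ℂ ℂ).smulRight n with hL
  have hLapp : ∀ x, L x = x.1 • deriv F ζ₀ + x.2 • n := fun x => rfl
  have hinj : Function.Injective L := by
    refine (injective_iff_map_eq_zero L).2 fun x hx => ?_
    rw [hLapp] at hx
    have h1 := congrArg (fun y => complexify y φ) hx
    simp only [complexify_add, complexify_smul, htanc, hnφ] at h1
    have h2 : x.2 = 0 := by simpa [complexify_apply] using h1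
    rw [h2] at hx
    have h3 : x.1 = 0 := by simpa [hF'] using hx
    exact Prod.ext h3 h2
  set L' : (ℂ × ℂ) ≃L[ℂ] (ℂ × ℂ) :=
    (LinearEquiv.ofInjectiveEndo L.toLinearMap hinj).toContinuousLinearEquiv with hL'
  have hL'L : (L' : ℂ × ℂ →L[ℂ] ℂ × ℂ) = L := ContinuousLinearMap.ext fun x => rfl
  set Φ : ℂ × ℂ → ℂ × ℂ := fun x => F x.1 + x.2 • n with hΦ
  have hFan : AnalyticAt ℂ F ζ₀ := by
    obtain ⟨s, hs, hso, hζs⟩ := _root_.eventually_nhds_iff.1 hF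
    exact DifferentiableOn.analyticAt (s := s)
      (fun ζ hζ => (hs ζ hζ).1.differentiableWithinAt) (hso.mem_nhds hζs)
  have hΦc : ContDiffAt ℂ ω Φ (ζ₀, 0) := by
    refine ContDiffAt.add ?_ (contDiffAt_snd.smul contDiffAt_const)
    exact ContDiffAt.comp (g := F) ((ζ₀, 0) : ℂ × ℂ) hFan.contDiffAt contDiffAt_fst
  have hΦd : HasFDerivAt Φ (L' : ℂ × ℂ →L[ℂ] ℂ × ℂ) (ζ₀, 0) := by
    rw [hL'L]
    have h1 : HasFDerivAt (fun x : ℂ × ℂ => F x.1) _ ((ζ₀, 0) : ℂ × ℂ) :=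
      HasFDerivAt.comp (g := F) ((ζ₀, 0) : ℂ × ℂ) hFd.hasFDerivAt hasFDerivAt_fst
    have h2 : HasFDerivAt (fun x : ℂ × ℂ => x.2 • n) _ ((ζ₀, 0) : ℂ × ℂ) :=
      (hasFDerivAt_snd (𝕜 := ℂ) (p := ((ζ₀, 0) : ℂ × ℂ))).smul_const n
    refine (h1.add h2).congr_fderiv ?_
    ext <;> simp [hL]
  set T := hΦc.toOpenPartialHomeomorph Φ hΦd (by simp) with hT
  have hTs : (ζ₀, 0) ∈ T.source := hΦc.mem_toOpenPartialHomeomorph_source hΦd (by simp)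
  have hTΦ : ∀ x, T x = Φ x := fun x => rfl
  have hT0 : ∀ ζ, T (ζ, 0) = F ζ := fun ζ => by simp [hTΦ, hΦ]
  have hTt : F ζ₀ ∈ T.target := hT0 ζ₀ ▸ T.map_source hTs
  have hTsymm : T.symm (F ζ₀) = (ζ₀, 0) := by rw [← hT0, T.left_inv hTs]
  refine ⟨T, hTs, hT0, ?_⟩
  have hdiff : ∀ᶠ x in 𝓝 (F ζ₀), DifferentiableAt ℂ T.symm x := by
    have h1 : ContDiffAt ℂ ω T.symm (Φ (ζ₀, 0)) := hΦc.to_localInverse hΦd (by simp)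
    rw [← hTΦ, hT0] at h1
    filter_upwards [(h1.of_le (m := 1) (by simp)).eventually (by simp)] with x hx
    exact hx.differentiableAt (by simp)
  have hstrict : HasStrictFDerivAt (r ∘ Φ) (φ.comp (L.restrictScalars ℝ)) (ζ₀, 0) := by
    have h1 : HasStrictFDerivAt Φ L ((ζ₀, 0) : ℂ × ℂ) :=
      hL'L ▸ hΦc.hasStrictFDerivAt' hΦd (by simp)
    have h2 : HasStrictFDerivAt r φ (Φ (ζ₀, 0)) := by
      rw [← hTΦ, hT0]; exact hr.hasStrictFDerivAt
    exact h2.comp ((ζ₀, 0) : ℂ × ℂ) (h1.restrictScalars ℝ)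
  have hcone : ∀ᶠ x in 𝓝 ((ζ₀, 0) : ℂ × ℂ), r (Φ x) = 0 → |x.2.im| ≤ ‖x.2‖ / 4 := by
    -- Strict differentiability allows comparing $(z,w)$ with $(z,0)$ for moving $z$. Both are zeros
    -- of $r\circ\Phi$, so the linear part $\mathrm{Im}\,w$ is at most $|w|/4$.
    have h1 := hstrict.isLittleO.bound (show (0 : ℝ) < 1 / 4 by norm_num)
    have h2 : Filter.Tendsto (fun x : ℂ × ℂ => (x, ((x.1, 0) : ℂ × ℂ))) (𝓝 (ζ₀, 0))
        (𝓝 ((ζ₀, 0), (ζ₀, 0))) := by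
      have : Continuous fun x : ℂ × ℂ => (x, ((x.1, 0) : ℂ × ℂ)) := by fun_prop
      exact this.tendsto (ζ₀, 0)
    have h3 : ∀ᶠ x in 𝓝 ((ζ₀, 0) : ℂ × ℂ), r (F x.1) = 0 :=
      (continuous_fst.tendsto ((ζ₀, 0) : ℂ × ℂ)).eventually (hF.mono fun _ h => h.2)
    filter_upwards [h2.eventually h1, h3] with x hx hx3 hx0
    have h4 : x - (x.1, 0) = (0, x.2) := by ext <;> simp
    have h5 : φ (x.2 • n) = x.2.im := by
      rw [← complexify_re, complexify_smul, hnφ]; simp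
    have h6 : r (Φ (x.1, 0)) = 0 := by rw [← hTΦ, hT0]; exact hx3
    simp only [Function.comp_apply, hx0, h6, h4, ContinuousLinearMap.comp_apply,
      ContinuousLinearMap.coe_restrictScalars', hLapp, zero_smul, zero_add, h5, sub_self,
      zero_sub, norm_neg, Real.norm_eq_abs, Prod.norm_def, norm_zero] at hx
    rw [max_eq_right (norm_nonneg _)] at hx
    linarith
  have hcont : Filter.Tendsto T.symm (𝓝 (F ζ₀)) (𝓝 (ζ₀, 0)) := by
    have := (T.symm.continuousAt (x := F ζ₀) hTt).tendsto
    rwa [hTsymm] at this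
  filter_upwards [hdiff, hcont.eventually hcone, T.open_target.mem_nhds hTt] with x h1 h2 h3
  refine ⟨h1, fun hx => h2 ?_⟩
  rw [← hTΦ, T.right_inv h3, hx]

variable {M : Type*} [TopologicalSpace M] [ChartedSpace (ℂ × ℂ) M]

theorem mdifferentiable_of_mem_maximalAtlas {e : OpenPartialHomeomorph M (ℂ × ℂ)}
    (he : e ∈ IsManifold.maximalAtlas 𝓘(ℂ, ℂ × ℂ) ω M) :
    e.MDifferentiable 𝓘(ℂ, ℂ × ℂ) 𝓘(ℂ, ℂ × ℂ) :=
  ⟨(contMDiffOn_of_mem_maximalAtlas he).mdifferentiableOn (by simp),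
    (contMDiffOn_symm_of_mem_maximalAtlas he).mdifferentiableOn (by simp)⟩

/-- The real part of a holomorphic function is plurisubharmonic. -/
theorem isPlurisubharmonicOn_re {h : M → ℂ} {W : Set M} (hW : IsOpen W)
    (hh : MDifferentiableOn 𝓘(ℂ, ℂ × ℂ) 𝓘(ℂ, ℂ) h W) :
    IsPlurisubharmonicOn (fun q => (h q).re) W := by
  refine ⟨(Complex.continuous_re.comp_continuousOn hh.continuousOn).upperSemicontinuousOn,
    fun f R hR hf hfW => ?_⟩
  have hd : ∀ ζ ∈ closedBall (0 : ℂ) 1, DifferentiableAt ℂ (h ∘ f) ζ := by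
    intro ζ hζ
    have h1 : f ζ ∈ W := hfW (mem_image_of_mem f hζ)
    have h2 := (hf ζ (closedBall_subset_ball hR hζ)).mdifferentiableAt
      (isOpen_ball.mem_nhds (closedBall_subset_ball hR hζ))
    exact (((hh _ h1).mdifferentiableAt (hW.mem_nhds h1)).comp ζ h2).differentiableAt
  have hdc : DifferentiableOn ℂ (h ∘ f) (closedBall 0 1) := fun ζ hζ =>
    (hd ζ hζ).differentiableWithinAt
  have hci : CircleIntegrable (h ∘ f) 0 1 :=
    (hdc.continuousOn.mono sphere_subset_closedBall).circleIntegrable zero_le_one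
  have hcont : ContinuousOn (fun ζ => (h (f ζ)).re) (sphere 0 1) :=
    Complex.continuous_re.comp_continuousOn (hdc.continuousOn.mono sphere_subset_closedBall)
  refine ⟨hcont.circleIntegrable zero_le_one, le_of_eq ?_⟩
  have h1 : Real.circleAverage (h ∘ f) 0 1 = (h ∘ f) 0 := by
    refine DiffContOnCl.circleAverage ?_
    rw [abs_one]
    exact DifferentiableOn.diffContOnCl (by rwa [closure_ball _ one_ne_zero])
  have h2 := Complex.reCLM.circleAverage_comp_comm hci
  rw [h1] at h2
  exact h2.symm

/-- Some plaque passes through each point of a Levi-flat hypersurface. -/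
theorem exists_plaque {S : Set M} (hS : IsRegularAnalyticHypersurface S) (hLevi : IsLeviFlat S)
    {p : M} (hp : p ∈ S) : ∃ P, IsLeviPlaque S P ∧ p ∈ P := by
  obtain ⟨e, U, r, hr, hpe, hpU⟩ := hS p hp
  have he := mdifferentiable_of_mem_maximalAtlas hr.chart
  have hp0 : r (e p) = 0 := (hr.mem_iff _ hpU).1 (by rwa [e.left_inv hpe])
  obtain ⟨f, hf0, hfi, hf⟩ := hasDisc hr.isOpen hr.analytic (hLevi e U r hr) hpU hp0
    (hr.regular _ hpU)
  have hft : ∀ ζ ∈ ball (0 : ℂ) 1, f ζ ∈ e.target := fun ζ hζ => hr.subset_target (hf ζ hζ).1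
  have hs : ∀ ζ ∈ ball (0 : ℂ) 1, MDifferentiableAt 𝓘(ℂ, ℂ × ℂ) 𝓘(ℂ, ℂ × ℂ) e.symm (f ζ) :=
    fun ζ hζ => he.mdifferentiableAt_symm (hft ζ hζ)
  refine ⟨(e.symm ∘ f) '' ball 0 1, ⟨?_, e.symm ∘ f, fun ζ hζ => ?_, ?_, fun ζ hζ => ?_, rfl⟩,
    0, by simp, by simp [hf0, e.left_inv hpe]⟩
  · rintro _ ⟨ζ, hζ, rfl⟩
    exact (hr.mem_iff _ (hf ζ hζ).1).2 (hf ζ hζ).2.1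
  · exact ((hs ζ hζ).comp ζ (hf ζ hζ).2.2.1.mdifferentiableAt).mdifferentiableWithinAt
  · exact e.symm.injOn.comp hfi hft
  · rw [mfderiv_comp ζ (hs ζ hζ) (hf ζ hζ).2.2.1.mdifferentiableAt, mfderiv_eq_fderiv]
    exact (he.symm.mfderiv_injective (hft ζ hζ)).comp (hf ζ hζ).2.2.2

/-- Near each of its points a plaque is a coordinate line of holomorphic coordinates in which
the hypersurface lies in a narrow cone around `ℂ × ℝ`. -/
theorem exists_adapted_chart {S : Set M} (hS : IsRegularAnalyticHypersurface S) {f : ℂ → M}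
    {ζ₀ : ℂ} (hfd : ∀ᶠ ζ in 𝓝 ζ₀, MDifferentiableAt 𝓘(ℂ, ℂ) 𝓘(ℂ, ℂ × ℂ) f ζ ∧ f ζ ∈ S)
    (hf' : Function.Injective (mfderiv 𝓘(ℂ, ℂ) 𝓘(ℂ, ℂ × ℂ) f ζ₀)) :
    ∃ Ψ : OpenPartialHomeomorph M (ℂ × ℂ), f ζ₀ ∈ Ψ.source ∧ Ψ (f ζ₀) = (ζ₀, 0) ∧
      MDifferentiableOn 𝓘(ℂ, ℂ × ℂ) 𝓘(ℂ, ℂ × ℂ) Ψ Ψ.source ∧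
      (∀ q ∈ S ∩ Ψ.source, ‖(Ψ q).2‖ ^ 2 / 2 ≤ ((Ψ q).2 ^ 2).re) ∧
      ∀ᶠ ζ in 𝓝 ζ₀, Ψ.symm (ζ, 0) = f ζ := by
  obtain ⟨hfd₀, hfS⟩ := hfd.self_of_nhds
  obtain ⟨e, U, r, hr, hpe, hpU⟩ := hS _ hfS
  have he := mdifferentiable_of_mem_maximalAtlas hr.chart
  have hes : ∀ᶠ ζ in 𝓝 ζ₀, f ζ ∈ e.source :=
    hfd₀.continuousAt.eventually (e.open_source.mem_nhds hpe)
  have heU : ∀ᶠ ζ in 𝓝 ζ₀, e (f ζ) ∈ U :=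
    ((e.continuousAt hpe).comp hfd₀.continuousAt).eventually (hr.isOpen.mem_nhds hpU)
  have hder : deriv (e ∘ f) ζ₀ ≠ 0 := by
    intro h0
    have h1 : mfderiv 𝓘(ℂ, ℂ) 𝓘(ℂ, ℂ × ℂ) (e ∘ f) ζ₀ =
        (mfderiv 𝓘(ℂ, ℂ × ℂ) 𝓘(ℂ, ℂ × ℂ) e (f ζ₀)).comp
          (mfderiv 𝓘(ℂ, ℂ) 𝓘(ℂ, ℂ × ℂ) f ζ₀) :=
      mfderiv_comp ζ₀ (he.mdifferentiableAt hpe) hfd₀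
    have h2 : Function.Injective (mfderiv 𝓘(ℂ, ℂ) 𝓘(ℂ, ℂ × ℂ) (e ∘ f) ζ₀) := by
      rw [h1]
      exact (he.mfderiv_injective hpe).comp hf'
    rw [mfderiv_eq_fderiv] at h2
    have h3 : fderiv ℂ (e ∘ f) ζ₀ (1 : ℂ) = fderiv ℂ (e ∘ f) ζ₀ (0 : ℂ) := by
      rw [fderiv_apply_one_eq_deriv, h0, map_zero]
    exact one_ne_zero (α := ℂ) (h2 h3)
  obtain ⟨T, hTs, hT0, hT⟩ := exists_straightening (r := r) (F := e ∘ f) (ζ₀ := ζ₀)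
    (hr.analytic _ hpU) (hr.regular _ hpU) (by
      filter_upwards [hfd, hes, heU] with ζ h1 h2 h3
      refine ⟨((he.mdifferentiableAt h2).comp ζ h1.1).differentiableAt, ?_⟩
      exact (hr.mem_iff _ h3).1 (by rw [e.left_inv h2]; exact h1.2)) hder
  obtain ⟨O, hO, hOo, hpO⟩ := _root_.eventually_nhds_iff.1 (hT.and (hr.isOpen.mem_nhds hpU))
  have hTsymm : T.symm (e (f ζ₀)) = (ζ₀, 0) := by
    have := T.left_inv hTs
    rwa [hT0] at this
  have hTt : e (f ζ₀) ∈ T.target := by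
    have := T.map_source hTs
    rwa [hT0] at this
  set Ψ := (e.trans T.symm).restrOpen (e.source ∩ e ⁻¹' O) (e.isOpen_inter_preimage hOo) with hΨ
  have hΨs : ∀ q ∈ Ψ.source, q ∈ e.source ∧ e q ∈ O := fun q hq => hq.2
  refine ⟨Ψ, ⟨?_, hpe, hpO⟩, hTsymm, fun q hq => ?_, fun q hq => ?_, ?_⟩
  · exact ⟨hpe, hTt⟩
  · obtain ⟨h1, h2⟩ := hΨs q hq
    exact ((hO _ h2).1.1.mdifferentiableAt.comp q
      (he.mdifferentiableAt h1)).mdifferentiableWithinAt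
  · obtain ⟨h1, h2⟩ := hΨs q hq.2
    have h3 : |(Ψ q).2.im| ≤ ‖(Ψ q).2‖ / 4 := (hO _ h2).1.2
      ((hr.mem_iff _ (hO _ h2).2).1 (by rw [e.left_inv h1]; exact hq.1))
    -- $\mathrm{Re}\,w^2=|w|^2-2(\mathrm{Im}\,w)^2\ge\frac78|w|^2$ in the cone, more than the half
    -- that is claimed.
    have h4 : ((Ψ q).2 ^ 2).re = ‖(Ψ q).2‖ ^ 2 - 2 * |(Ψ q).2.im| ^ 2 := by
      rw [sq_abs, ← Complex.normSq_eq_norm_sq, Complex.normSq_apply, pow_two, Complex.mul_re]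
      ring
    have h5 : |(Ψ q).2.im| ^ 2 ≤ (‖(Ψ q).2‖ / 4) ^ 2 := by gcongr
    rw [h4]
    nlinarith [sq_nonneg ‖(Ψ q).2‖]
  · filter_upwards [hes] with ζ hζ
    change e.symm (T (ζ, 0)) = f ζ
    rw [hT0]
    exact e.left_inv hζ

end

/-! ### The local maximum argument -/

/-- The reciprocal function centred in a disc peaks at any boundary point of the disc, relative
to the complement of the disc. -/
theorem re_div_lt_one {z z₁ z₂ : ℂ} (h : ‖z₂ - z₁‖ ≤ ‖z - z₁‖) (h0 : 0 < ‖z₂ - z₁‖)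
    (hne : z ≠ z₂) : ((z₂ - z₁) / (z - z₁)).re < 1 := by
  by_contra! hc
  have hz : z - z₁ ≠ 0 := norm_pos_iff.1 (h0.trans_le h)
  set c := (z₂ - z₁) / (z - z₁) with hcdef
  have hn : ‖c‖ ≤ 1 := by
    rw [hcdef, norm_div]
    exact div_le_one_of_le₀ h (norm_nonneg _)
  have hsq : c.re * c.re + c.im * c.im ≤ 1 := by
    rw [← Complex.normSq_apply, Complex.normSq_eq_norm_sq]
    nlinarith [norm_nonneg c]
  have him : c.im = 0 := by nlinarith [mul_self_nonneg c.im]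
  have hre : c.re = 1 := le_antisymm (by nlinarith [mul_self_nonneg c.im]) hc
  have hc1 : c = 1 := Complex.ext hre him
  rw [hcdef, div_eq_one_iff_eq hz] at hc1
  exact hne (by linear_combination -hc1)

variable {M : Type*} [TopologicalSpace M] [T2Space M] [ChartedSpace (ℂ × ℂ) M]

/-- A closed local maximum set lying in a narrow cone around `ℂ × ℝ` contains, with a point of
the line `ℂ × {0}`, a neighbourhood of this point in the line. -/
theorem eventually_mem_of_isLocalMaximumSet {K : Set M} (hKc : IsClosed K)
    (hK : IsLocalMaximumSet K) {Ψ : OpenPartialHomeomorph M (ℂ × ℂ)}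
    (hΨ : MDifferentiableOn 𝓘(ℂ, ℂ × ℂ) 𝓘(ℂ, ℂ × ℂ) Ψ Ψ.source)
    (hcone : ∀ q ∈ K ∩ Ψ.source, ‖(Ψ q).2‖ ^ 2 / 2 ≤ ((Ψ q).2 ^ 2).re)
    {p : M} (hp : p ∈ K) (hps : p ∈ Ψ.source) {z₀ : ℂ} (hp0 : Ψ p = (z₀, 0)) :
    ∀ᶠ z in 𝓝 z₀, Ψ.symm (z, 0) ∈ K := by
  obtain ⟨V, hVo, hpV, hmax⟩ := hK.2 p hp
  have hsp : Ψ.symm (z₀, 0) = p := by rw [← hp0, Ψ.left_inv hps]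
  have hBo : IsOpen (Ψ.target ∩ Ψ.symm ⁻¹' V) := Ψ.isOpen_inter_preimage_symm hVo
  obtain ⟨ε', hε', hB⟩ := nhds_basis_closedBall.mem_iff.1 (hBo.mem_nhds
    (show ((z₀, 0) : ℂ × ℂ) ∈ _ from ⟨hp0 ▸ Ψ.map_source hps, by simpa [hsp] using hpV⟩))
  -- Three times $\varepsilon$: $z_1$ is within $\varepsilon$ of $z_0$, $z_2$ within $2\varepsilon$,
  -- and the bidisc about $(z_2,0)$ has radii at most $\varepsilon$.
  obtain ⟨ε, hε, rfl⟩ : ∃ ε > 0, ε' = 3 * ε := ⟨ε' / 3, by positivity, by ring⟩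
  have hmemB : ∀ z w : ℂ, ‖z - z₀‖ ≤ 3 * ε → ‖w‖ ≤ 3 * ε →
      (z, w) ∈ Ψ.target ∩ Ψ.symm ⁻¹' V := fun z w hz hw =>
    hB (mem_closedBall_prod hz (by simpa using hw))
  filter_upwards [ball_mem_nhds z₀ hε] with z₁ hz₁
  by_contra hz₁K
  rw [mem_ball, dist_eq_norm] at hz₁
  -- the point `z₂` of the slice nearest to `z₁`
  set s := closedBall z₀ (3 * ε) ∩ (fun z => Ψ.symm (z, 0)) ⁻¹' K with hs
  have hsc : IsCompact s := by
    refine (isCompact_closedBall _ _).of_isClosed_subset ?_ inter_subset_left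
    refine ContinuousOn.preimage_isClosed_of_isClosed ?_ isClosed_closedBall hKc
    refine Ψ.symm.continuousOn.comp (by fun_prop) fun z hz => ?_
    rw [mem_closedBall, dist_eq_norm] at hz
    exact (hmemB z 0 hz (by simpa using hε.le)).1
  have hz₀s : z₀ ∈ s := ⟨mem_closedBall_self (by positivity), by simpa [hsp] using hp⟩
  obtain ⟨z₂, hz₂s, hz₂min⟩ := hsc.exists_isMinOn ⟨z₀, hz₀s⟩
    (f := fun z => ‖z - z₁‖) (by fun_prop)
  have hmin : ∀ z ∈ s, ‖z₂ - z₁‖ ≤ ‖z - z₁‖ := fun z hz => hz₂min hz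
  set ρ := ‖z₂ - z₁‖ with hρ
  have hρ0 : 0 < ρ := by
    rw [hρ, norm_pos_iff, sub_ne_zero]
    rintro rfl
    exact hz₁K hz₂s.2
  have hρε : ρ < ε := (hmin z₀ hz₀s).trans_lt (by rwa [norm_sub_rev])
  have hz₂₀ : ‖z₂ - z₀‖ ≤ 2 * ε := by
    have := norm_sub_le_norm_sub_add_norm_sub z₂ z₁ z₀
    linarith
  -- Half the distance keeps the pole $z_1$ off the disc about $z_2$ and bounds the peak function
  -- there by $\rho/\eta=2$.
  set η := ρ / 2 with hη
  have hη0 : 0 < η := by positivity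
  have hnear : ∀ z : ℂ, ‖z - z₂‖ ≤ η → ‖z - z₀‖ ≤ 3 * ε ∧ η ≤ ‖z - z₁‖ := by
    intro z hz
    have h1 := norm_sub_le_norm_sub_add_norm_sub z z₂ z₀
    have h2 := norm_sub_le_norm_sub_add_norm_sub z₂ z z₁
    rw [norm_sub_rev z₂ z, ← hρ] at h2
    constructor <;> linarith
  -- the thickness `δ` in the transverse direction
  set v : ℂ → ℝ := fun z => ((z₂ - z₁) / (z - z₁)).re with hv
  obtain ⟨δ, hδ0, hδε, hδ⟩ : ∃ δ > 0, δ ≤ ε ∧ ∀ z w : ℂ, ‖z - z₂‖ = η → ‖w‖ ≤ δ →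
      Ψ.symm (z, w) ∈ K → v z < 1 := by
    set Q := sphere z₂ η ×ˢ closedBall (0 : ℂ) ε with hQ
    have hQn : ∀ x ∈ Q, ‖x.1 - z₂‖ = η ∧ ‖x.2‖ ≤ ε := fun x hx =>
      ⟨by simpa [dist_eq_norm] using hx.1, by simpa using hx.2⟩
    -- The bad points of $K$ over the circle form a compact set. It misses $w=0$, where
    -- `re_div_lt_one` applies, so $|w|$ has a positive lower bound on it.
    set t := Q ∩ (fun x => ((Ψ.symm x, v x.1) : M × ℝ)) ⁻¹' (K ×ˢ Ici 1) with ht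
    have hQc : IsCompact Q := (isCompact_sphere _ _).prod (isCompact_closedBall _ _)
    have htc : IsCompact t := by
      refine hQc.of_isClosed_subset ?_ inter_subset_left
      refine ContinuousOn.preimage_isClosed_of_isClosed ?_ hQc.isClosed
        (hKc.prod isClosed_Ici)
      refine ContinuousOn.prodMk (Ψ.symm.continuousOn.mono fun x hx => ?_) ?_
      · obtain ⟨h1, h2⟩ := hQn x hx
        exact (hmemB x.1 x.2 (hnear _ h1.le).1 (by linarith)).1
      · refine Complex.continuous_re.comp_continuousOn (continuousOn_const.div (by fun_prop) ?_)
        intro x hx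
        exact norm_pos_iff.1 (hη0.trans_le (hnear _ (hQn x hx).1.le).2)
    obtain ⟨δ', hδ', hδt⟩ := htc.exists_forall_le' (f := fun x => ‖x.2‖) (by fun_prop) (a := 0)
      (fun x hx => by
        rw [norm_pos_iff]
        intro h0
        obtain ⟨h1, -⟩ := hQn x hx.1
        have hxs : x.1 ∈ s := by
          refine ⟨by simpa [dist_eq_norm] using (hnear _ h1.le).1, ?_⟩
          have := hx.2.1
          rw [show x = (x.1, 0) from Prod.ext rfl h0] at this
          exact this
        have hne : x.1 ≠ z₂ := by
          intro h
          rw [h, sub_self, norm_zero] at h1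
          exact hη0.ne h1
        exact absurd hx.2.2 (not_le.2 (re_div_lt_one (hmin _ hxs) hρ0 hne)))
    refine ⟨min ε (δ' / 2), by positivity, min_le_left _ _, fun z w hz hw hzw => ?_⟩
    by_contra! hc
    have hw1 := hw.trans (min_le_left _ _)
    have hw2 := hw.trans (min_le_right _ _)
    have := hδt (z, w) ⟨⟨by simpa [dist_eq_norm] using hz, by simpa using hw1⟩, hzw, hc⟩
    simp only at this
    linarith
  -- the bidisc and the peaking pluriharmonic function
  set Q := closedBall z₂ η ×ˢ closedBall (0 : ℂ) δ with hQ
  have hQn : ∀ x ∈ Q, ‖x.1 - z₂‖ ≤ η ∧ ‖x.2‖ ≤ δ := fun x hx =>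
    ⟨by simpa [dist_eq_norm] using hx.1, by simpa using hx.2⟩
  have hQB : ∀ x ∈ Q, x ∈ Ψ.target ∩ Ψ.symm ⁻¹' V := fun x hx =>
    hmemB x.1 x.2 (hnear _ (hQn x hx).1).1 (by linarith [(hQn x hx).2])
  have hNc : IsCompact (Ψ.symm '' Q) :=
    ((isCompact_closedBall _ _).prod (isCompact_closedBall _ _)).image_of_continuousOn
      (Ψ.symm.continuousOn.mono fun x hx => (hQB x hx).1)
  set W := Ψ.source ∩ Ψ ⁻¹' {x | x.1 ≠ z₁} with hW
  have hWo : IsOpen W :=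
    Ψ.isOpen_inter_preimage (isOpen_compl_singleton.preimage continuous_fst)
  -- On $|w|=\delta$ the cone gives $\mathrm{Re}\,w^2\ge\delta^2/2$, so this factor subtracts at
  -- least 2, the bound of the peak function.
  set C : ℂ := ((4 / δ ^ 2 : ℝ) : ℂ) with hC
  set h : ℂ × ℂ → ℂ := fun x => (z₂ - z₁) / (x.1 - z₁) - C * x.2 ^ 2 with hh
  have hre : ∀ x, (h x).re = v x.1 - 4 / δ ^ 2 * (x.2 ^ 2).re := by
    intro x
    rw [hh, hC]
    simp only [Complex.sub_re, Complex.re_ofReal_mul, hv]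
  have hhd : MDifferentiableOn 𝓘(ℂ, ℂ × ℂ) 𝓘(ℂ, ℂ) (h ∘ Ψ) W := by
    intro q hq
    have h1 : DifferentiableAt ℂ h (Ψ q) := by
      have : (Ψ q).1 - z₁ ≠ 0 := sub_ne_zero.2 hq.2
      fun_prop (disch := assumption)
    exact (h1.mdifferentiableAt.comp q
      ((hΨ q hq.1).mdifferentiableAt (Ψ.open_source.mem_nhds hq.1))).mdifferentiableWithinAt
  have hz₂Q : (z₂, 0) ∈ Q := ⟨mem_closedBall_self hη0.le, mem_closedBall_self hδ0.le⟩
  obtain ⟨y, ⟨hyK, hyf⟩, hle⟩ := hmax (Ψ.symm '' Q) hNc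
    (by rintro _ ⟨x, hx, rfl⟩; exact (hQB x hx).2) W (fun q => ((h ∘ Ψ) q).re) hWo
    (by
      rintro _ ⟨x, hx, rfl⟩
      refine ⟨Ψ.map_target (hQB x hx).1, ?_⟩
      rw [mem_preimage, Ψ.right_inv (hQB x hx).1]
      exact sub_ne_zero.1 (norm_pos_iff.1 (hη0.trans_le (hnear _ (hQn x hx).1).2)))
    (isPlurisubharmonicOn_re hWo hhd) (Ψ.symm (z₂, 0)) ⟨hz₂s.2, mem_image_of_mem _ hz₂Q⟩
  obtain ⟨x, hxQ, rfl⟩ := hNc.isClosed.frontier_subset hyf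
  obtain ⟨hx1, hx2⟩ := hQn x hxQ
  have hxt := (hQB x hxQ).1
  simp only [Function.comp_apply, hre, Ψ.right_inv hxt, Ψ.right_inv (hQB _ hz₂Q).1] at hle
  have hv₂ : v z₂ = 1 := by
    have : z₂ - z₁ ≠ 0 := norm_pos_iff.1 hρ0
    simp [hv, div_self this]
  have hcx := hcone _ ⟨hyK, Ψ.map_target hxt⟩
  rw [Ψ.right_inv hxt] at hcx
  rw [hv₂] at hle
  have hsq0 : 0 ≤ (x.2 ^ 2).re := le_trans (by positivity) hcx
  have hle1 : 1 ≤ v x.1 - 4 / δ ^ 2 * (x.2 ^ 2).re := by simpa using hle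
  -- The chart carries the open bidisc to an open subset of $M$, so frontier points come from the
  -- boundary of the bidisc.
  have hbd : ‖x.1 - z₂‖ = η ∨ ‖x.2‖ = δ := by
    by_contra! hc
    refine hyf.2 (mem_interior.2 ⟨Ψ.symm '' (ball z₂ η ×ˢ ball (0 : ℂ) δ), ?_, ?_, ?_⟩)
    · exact image_mono (prod_mono ball_subset_closedBall ball_subset_closedBall)
    · refine Ψ.symm.isOpen_image_of_subset_source (isOpen_ball.prod isOpen_ball) fun x hx => ?_
      exact (hQB x (prod_mono ball_subset_closedBall ball_subset_closedBall hx)).1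
    · refine mem_image_of_mem _ ⟨?_, ?_⟩
      · simpa [dist_eq_norm] using lt_of_le_of_ne hx1 hc.1
      · simpa using lt_of_le_of_ne hx2 hc.2
  rcases hbd with hb | hb
  · have := hδ x.1 x.2 hb hx2 hyK
    have : 0 ≤ 4 / δ ^ 2 * (x.2 ^ 2).re := by positivity
    linarith
  · have h1 : v x.1 ≤ 2 := by
      refine (Complex.re_le_norm _).trans ?_
      rw [norm_div, ← hρ, div_le_iff₀ (hη0.trans_le (hnear _ hx1).2)]
      linarith [(hnear _ hx1).2]
    rw [hb] at hcx
    have h2 : 4 / δ ^ 2 * (δ ^ 2 / 2) ≤ 4 / δ ^ 2 * (x.2 ^ 2).re := by gcongr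
    have h3 : 4 / δ ^ 2 * (δ ^ 2 / 2) = 2 := by field_simp; norm_num
    linarith

/-- A plaque that meets a closed local maximum set contained in `S` lies in this set. -/
theorem IsLeviPlaque.subset_of_isLocalMaximumSet {S K P : Set M}
    (hS : IsRegularAnalyticHypersurface S) (hKc : IsClosed K) (hK : IsLocalMaximumSet K)
    (hKS : K ⊆ S) (hP : IsLeviPlaque S P) {p : M} (hpP : p ∈ P) (hpK : p ∈ K) : P ⊆ K := by
  obtain ⟨hPS, f, hfd, -, hf', rfl⟩ := hP
  obtain ⟨ζ, hζ, rfl⟩ := hpP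
  have hd : ∀ ζ ∈ ball (0 : ℂ) 1, MDifferentiableAt 𝓘(ℂ, ℂ) 𝓘(ℂ, ℂ × ℂ) f ζ := fun ζ hζ =>
    (hfd ζ hζ).mdifferentiableAt (isOpen_ball.mem_nhds hζ)
  have hopen : IsOpen (ball (0 : ℂ) 1 ∩ f ⁻¹' K) := by
    rw [isOpen_iff_mem_nhds]
    rintro ζ ⟨hζ, hζK⟩
    obtain ⟨Ψ, hs, h0, hΨ, hcone, hsymm⟩ := exists_adapted_chart hS (f := f) (ζ₀ := ζ)
      (by
        filter_upwards [isOpen_ball.mem_nhds hζ] with ξ hξ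
        exact ⟨hd ξ hξ, hPS (mem_image_of_mem f hξ)⟩) (hf' ζ hζ)
    filter_upwards [isOpen_ball.mem_nhds hζ, hsymm, eventually_mem_of_isLocalMaximumSet hKc hK hΨ
      (fun q hq => hcone q ⟨hKS hq.1, hq.2⟩) hζK hs h0] with ξ h1 h2 h3
    rw [h2] at h3
    exact ⟨h1, h3⟩
  -- The trace of $K$ on the connected disc is nonempty, open and relatively closed.
  have hsub : ball (0 : ℂ) 1 ⊆ ball (0 : ℂ) 1 ∩ f ⁻¹' K := by
    refine (convex_ball (0 : ℂ) 1).isPreconnected.subset_of_closure_inter_subset hopen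
      ⟨ζ, hζ, hζ, hpK⟩ ?_
    rintro ξ ⟨hξc, hξ⟩
    refine ⟨hξ, ?_⟩
    have h1 := (hd ξ hξ).continuousAt.continuousWithinAt.mem_closure_image hξc
    exact closure_minimal (by rintro _ ⟨ξ', h, rfl⟩; exact h.2) hKc h1
  rintro _ ⟨ξ, hξ, rfl⟩
  exact (hsub hξ).2

end LeviFlat

theorem mainTheorem8 {M : Type*} [TopologicalSpace M] [T2Space M] [ChartedSpace (ℂ × ℂ) M]
    [IsManifold 𝓘(ℂ, ℂ × ℂ) ω M]
    (S : Set M) (hScompact : IsCompact S)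
    (hS : LeviFlat.IsRegularAnalyticHypersurface S) (hLevi : LeviFlat.IsLeviFlat S)
    (K : Set M) (hKcompact : IsCompact K) (hK : LeviFlat.IsLocalMaximumSet K) (hKS : K ⊆ S) :
    ∃ 𝓕 : Set (Set M), (∀ L ∈ 𝓕, LeviFlat.IsLeviLeaf S L) ∧ K = ⋃₀ 𝓕 := by
  refine ⟨LeviFlat.leviLeaf S '' K, ?_, Subset.antisymm (fun p hp => ?_) ?_⟩
  · rintro _ ⟨p, hp, rfl⟩
    exact ⟨p, hKS hp, rfl⟩
  -- Chains have at least one link, so a plaque through $p$ is needed to place $p$ in its own leaf.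
  · obtain ⟨P, hP, hpP⟩ := LeviFlat.exists_plaque hS hLevi (hKS hp)
    exact ⟨_, mem_image_of_mem _ hp, Relation.TransGen.single ⟨P, hP, hpP, hpP⟩⟩
  · rintro q ⟨_, ⟨p, hp, rfl⟩, hq⟩
    induction hq with
    | single h =>
      obtain ⟨P, hP, hpP, hqP⟩ := h
      exact hP.subset_of_isLocalMaximumSet hS hKcompact.isClosed hK hKS hpP hp hqP
    | tail _ h ih =>
      obtain ⟨P, hP, hpP, hqP⟩ := h
      exact hP.subset_of_isLocalMaximumSet hS hKcompact.isClosed hK hKS hpP ih hqP
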